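/- Let $q=p^r$ with $p$ prime and $r\ge 1$, and let $A\Gamma L(1,q)$ be the group of all permutations $x\mapsto a\,\sigma(x)+b$ of $\mathbb F_q$ with $a\in\mathbb F_q^*$, $b\in\mathbb F_q$, $\sigma\in\mathrm{Aut}(\mathbb F_q)$. Let $\Gamma$ be an undirected loopless graph with point set $\mathbb F_q$ such that $\mathrm{Aut}(\Gamma)\cap A\Gamma L(1,q)$ is a rank three group, i.e. it is transitive on $\mathbb F_q$ and has exactly three orbits on $\mathbb F_q\times\mathbb F_q$. Then $\Gamma$ or its complement is isomorphic, through a map $x\mapsto ax$ with $a\in\mathbb F_q^*$, to one of the following graphs. Here $\mathrm{Cay}(\mathbb F_q^+,S)$ denotes the graph on $\mathbb F_q$ in which $x$ and $y$ are adjacent if and only if $y-x\in S$, where $S=-S$ and $0\notin S$. 1. A Van Lint–Schrijver graph: $\mathrm{Cay}(\mathbb F_q^+,C)$, where $\ell$ is a prime such that $p$ has multiplicative order $\ell-1$ modulo $\ell$ and $(\ell-1)\mid r$, and $C$ is the subgroup of index $\ell$ of $\mathbb F_q^*$. 2. The Paley graph: $\mathrm{Cay}(\mathbb F_q^+,S)$,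 where $q\equiv 1\pmod 4$ and $S$ is the set of nonzero squares of $\mathbb F_q$. 3. A Peisert graph: $\mathrm{Cay}(\mathbb F_q^+,C\cup C\omega)$, where $p\equiv 3\pmod 4$, $r$ is even, $\omega$ is a generator of $\mathbb F_q^*$ and $C=\langle\omega^4\rangle$. -/

import Mathlib

/-- The automorphism group of a graph, as a permutation group on its points. -/
def graphAut {V : Type*} (Γ : SimpleGraph V) : Subgroup (Equiv.Perm V) where
  carrier := {g | ∀ x y, Γ.Adj (g x) (g y) ↔ Γ.Adj x y}
  mul_mem' := by
    intro g h hg hh x y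
    rw [Equiv.Perm.mul_apply, Equiv.Perm.mul_apply, hg, hh]
  one_mem' := by
    intro x y
    rfl
  inv_mem' := by
    intro g hg x y
    have h := hg (g⁻¹ x) (g⁻¹ y)
    simpa using h.symm

/-- The one-dimensional affine semilinear group of a field `F`, as a permutation group on `F`:
all maps `x ↦ a * σ x + b` with `a ≠ 0` and `σ` a field automorphism of `F`. -/
def affineSemilinearGroup (F : Type*) [Field F] : Subgroup (Equiv.Perm F) where
  carrier := {g | ∃ (a : Fˣ) (σ : F ≃+* F) (b : F), ∀ x, g x = a * σ x + b}
  mul_mem' := by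
    rintro g h ⟨a, σ, b, hg⟩ ⟨c, τ, d, hh⟩
    refine ⟨a * Units.map (σ : F →* F) c, τ.trans σ, a * σ d + b, fun x => ?_⟩
    rw [Equiv.Perm.mul_apply, hg, hh]
    simp
    ring
  one_mem' := ⟨1, RingEquiv.refl F, 0, fun x => by simp⟩
  inv_mem' := by
    rintro g ⟨a, σ, b, hg⟩
    refine ⟨Units.map (σ.symm : F →* F) a⁻¹, σ.symm, -(σ.symm ((a⁻¹ : Fˣ) * b)), fun x => ?_⟩
    apply g.injective
    rw [show g (g⁻¹ x) = x from g.apply_symm_apply x, hg]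
    simp
    field_simp
    ring

/-- A permutation group has rank three if it is transitive and has exactly three orbits
on ordered pairs of points. -/
def IsRankThree {V : Type*} (G : Subgroup (Equiv.Perm V)) : Prop :=
  MulAction.IsPretransitive G V ∧ Nat.card (MulAction.orbitRel.Quotient G (V × V)) = 3

/-- A graph on a field `F` is a one-dimensional affine rank three graph if the intersection of its
automorphism group with the one-dimensional affine semilinear group has rank three. -/
def IsAffineRankThreeGraph {F : Type*} [Field F] (Γ : SimpleGraph F) : Prop :=
  IsRankThree (graphAut Γ ⊓ affineSemilinearGroup F)

/-- The graph `Γ` is the Cayley graph of the additive group of `F` with connection set `S`: its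
arcs are precisely the pairs `(x, x + s)` with `s ∈ S`. (No symmetrization takes place, so this
forces `S = -S` and `0 ∉ S`.) -/
def IsCayleyGraph {F : Type*} [Field F] (Γ : SimpleGraph F) (S : Set F) : Prop :=
  ∀ x y, Γ.Adj x y ↔ y - x ∈ S

/-- `Γ` is a Van Lint - Schrijver graph: for some primes `p` and `ℓ` such that `p` has
multiplicative order `ℓ - 1` modulo `ℓ`, the field has `p ^ ((ℓ - 1) * k)` elements with `k ≥ 1`,
and the connection set is the subgroup generated by the `ℓ`-th power of a primitive element,
that is, the subgroup of index `ℓ` of the multiplicative group. -/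
def IsVanLintSchrijverGraph {F : Type*} [Field F] (Γ : SimpleGraph F) : Prop :=
  ∃ p ℓ k : ℕ, p.Prime ∧ ℓ.Prime ∧ 0 < k ∧ orderOf (p : ZMod ℓ) = ℓ - 1 ∧
    Nat.card F = p ^ ((ℓ - 1) * k) ∧
    ∃ ω : Fˣ, Subgroup.zpowers ω = ⊤ ∧
      IsCayleyGraph Γ {x : F | ∃ u ∈ Subgroup.zpowers (ω ^ ℓ), x = u}

/-- `Γ` is a Paley graph: the field has `q` elements with `q ≡ 1 (mod 4)`, and the connection set
consists of the nonzero squares. -/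
def IsPaleyGraph {F : Type*} [Field F] (Γ : SimpleGraph F) : Prop :=
  Nat.card F % 4 = 1 ∧ IsCayleyGraph Γ {x : F | x ≠ 0 ∧ IsSquare x}

/-- `Γ` is a Peisert graph: the field has `p ^ r` elements with `p ≡ 3 (mod 4)` prime and `r`
positive and even, and the connection set is `C ∪ Cω`, where `ω` is a primitive element and `C` is
the subgroup generated by `ω ^ 4`. -/
def IsPeisertGraph {F : Type*} [Field F] (Γ : SimpleGraph F) : Prop :=
  ∃ p r : ℕ, p.Prime ∧ p % 4 = 3 ∧ 0 < r ∧ Even r ∧ Nat.card F = p ^ r ∧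
    ∃ ω : Fˣ, Subgroup.zpowers ω = ⊤ ∧
      IsCayleyGraph Γ {x : F | ∃ u ∈ Subgroup.zpowers (ω ^ 4), x = u ∨ x = u * ω}

/-- The graph `Γ` is isomorphic to `Δ` through multiplication by some nonzero field element. -/
def IsScalarIsomorphic {F : Type*} [Field F] (Γ Δ : SimpleGraph F) : Prop :=
  ∃ (a : Fˣ) (e : Γ ≃g Δ), ∀ x, e x = a * x

/-! The group contains all translations: a transitive affine semilinear group contains a nontrivial
one (`exists_addRight_mem`), and rank three spreads this to invariance of the graph under every
translation (`IsAffineRankThreeGraph.adj_add_right_iff`). So the graph is determined by the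
neighbours of `0`, hence by the set `A` of their exponents to a primitive element `ω`.

Let `nℤ` be the group of periods of `A`. The field automorphisms that occur form a cyclic group; a
generator, with its scalar, acts on exponents as `i ↦ s * i + c` with `s` a power of `p`. Rank three
then says that this map has exactly two cycles modulo `n`, namely `A` and its complement
(`IsAffineRankThreeGraph.exists_isTwoCycleSet`). Modulo a proper divisor of `n` it is a single
cycle, since otherwise `A` would have a smaller period.

If the map has a fixed point, then `n` is prime, `A` or its complement is one residue class, and the
powers of `s` exhaust the nonzero residues (`IsTwoCycleSet.of_fixed`): a Van Lint–Schrijver graph.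
If it has none, only the condition at 4 of the Hull–Dobell theorem can fail, which forces `n = 4`
and two consecutive classes (`IsTwoCycleSet.of_not_fixed`): a Peisert graph. The Paley graphs are
the case `ℓ = 2` of the first family. -/

/-! ### Cycles of affine maps modulo `n` -/

open Finset in
/-- The iterates of an affine map of `ℤ`. -/
theorem affine_iterate (s c i : ℤ) (k : ℕ) :
    (fun x : ℤ => s * x + c)^[k] i = s ^ k * i + c * ∑ j ∈ range k, s ^ j := by
  induction k with
  | zero => simp
  | succ k ih =>
    rw [Function.iterate_succ_apply', ih, geom_sum_succ]
    ring

theorem affine_iterate_modEq {n s c i j : ℤ} (h : i ≡ j [ZMOD n]) (k : ℕ) :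
    (fun x : ℤ => s * x + c)^[k] i ≡ (fun x : ℤ => s * x + c)^[k] j [ZMOD n] := by
  rw [affine_iterate, affine_iterate]
  exact (h.mul_left _).add_right _

open Finset in
theorem geom_sum_modEq_of_dvd_sub_one {m s : ℤ} (h : m ∣ s - 1) (k : ℕ) :
    ∑ j ∈ range k, s ^ j ≡ k [ZMOD m] := by
  have h1 : s ≡ 1 [ZMOD m] := (Int.modEq_iff_dvd.2 h).symm
  induction k with
  | zero => simp
  | succ k ih =>
    rw [sum_range_succ]
    push_cast
    exact ih.add (by simpa using h1.pow k)

open Finset in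
/-- The core of the Hull–Dobell theorem on the periods of linear congruential generators. -/
theorem dvd_of_dvd_geom_sum {n : ℕ} {s : ℤ}
    (h : ∀ ℓ : ℕ, ℓ.Prime → ℓ ∣ n → (ℓ : ℤ) ∣ s - 1) (h4 : 4 ∣ n → (4 : ℤ) ∣ s - 1) {k : ℕ}
    (hk : (n : ℤ) ∣ ∑ j ∈ range k, s ^ j) : n ∣ k := by
  by_cases hs : s = 1
  · subst hs
    simpa [Int.natCast_dvd_natCast] using hk
  rw [Nat.dvd_iff_prime_pow_dvd_dvd]
  intro ℓ e hℓ he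
  rcases Nat.eq_zero_or_pos e with rfl | hepos
  · simp
  have hℓn : ℓ ∣ n := (dvd_pow_self ℓ hepos.ne').trans he
  have hℓs := h ℓ hℓ hℓn
  have hsum : ((ℓ ^ e : ℕ) : ℤ) ∣ ∑ j ∈ range k, s ^ j := (Int.natCast_dvd_natCast.2 he).trans hk
  -- Lifting the exponent at 2 needs `4 ∣ s - 1`, which may fail here; modulo 2 the sum is just `k`.
  by_cases he2 : ℓ = 2 ∧ e = 1
  · obtain ⟨rfl, rfl⟩ := he2
    rw [pow_one] at hsum ⊢
    exact Int.natCast_dvd_natCast.1 ((geom_sum_modEq_of_dvd_sub_one hℓs k).dvd_iff.1 hsum)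
  have hndvd : ¬ (ℓ : ℤ) ∣ s := fun hd => by
    have h1 : (ℓ : ℤ) ∣ 1 := by simpa using dvd_sub hd hℓs
    exact hℓ.one_lt.ne' (by exact_mod_cast Int.eq_one_of_dvd_one (by positivity) h1)
  -- Lifting the exponent: after cancelling `s - 1`, the geometric sum and `k` have the same
  -- `ℓ`-adic valuation.
  have key : emultiplicity (ℓ : ℤ) (s ^ k - 1) =
      emultiplicity (ℓ : ℤ) (s - 1) + emultiplicity (ℓ : ℤ) k := by
    rcases hℓ.eq_two_or_odd' with rfl | hodd
    · have h4n : 4 ∣ n := by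
        refine (pow_dvd_pow 2 (?_ : 2 ≤ e)).trans he
        have : e ≠ 1 := fun h => he2 ⟨rfl, h⟩
        omega
      simpa using Int.two_pow_sub_pow' k (h4 h4n) hndvd
    · simpa [Int.natCast_emultiplicity] using
        Int.emultiplicity_pow_sub_pow (p := ℓ) hℓ hodd (y := 1) hℓs hndvd k
  rw [← geom_sum_mul, emultiplicity_mul (Nat.prime_iff_prime_int.1 hℓ), add_comm] at key
  have hfin : emultiplicity (ℓ : ℤ) (s - 1) ≠ ⊤ :=
    finiteMultiplicity_iff_emultiplicity_ne_top.1
      (Int.finiteMultiplicity_iff.2 ⟨by simpa using hℓ.ne_one, sub_ne_zero.2 hs⟩)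
  have key2 := ENat.add_right_injective_of_ne_top hfin key
  have : ((ℓ : ℤ) ^ e) ∣ (k : ℤ) := by
    rw [pow_dvd_iff_le_emultiplicity, ← key2, ← pow_dvd_iff_le_emultiplicity]
    exact_mod_cast hsum
  exact_mod_cast this

/-- The Hull–Dobell theorem: under its conditions an affine map modulo `n` is a single cycle. -/
theorem exists_affine_iterate_modEq {n : ℕ} (hn : 0 < n) {s c : ℤ}
    (h : ∀ ℓ : ℕ, ℓ.Prime → ℓ ∣ n → (ℓ : ℤ) ∣ s - 1 ∧ ¬ (ℓ : ℤ) ∣ c)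
    (h4 : 4 ∣ n → (4 : ℤ) ∣ s - 1) (j : ℤ) :
    ∃ k : ℕ, (fun x : ℤ => s * x + c)^[k] 0 ≡ j [ZMOD n] := by
  have : NeZero n := ⟨hn.ne'⟩
  have hc : IsCoprime (n : ℤ) c := by
    rw [Int.isCoprime_iff_gcd_eq_one]
    refine Nat.coprime_of_dvd fun ℓ hℓ h1 h2 => (h ℓ hℓ (by simpa using h1)).2 ?_
    exact Int.natCast_dvd.2 h2
  have hs : IsCoprime (n : ℤ) s := by
    rw [Int.isCoprime_iff_gcd_eq_one]
    refine Nat.coprime_of_dvd fun ℓ hℓ h1 h2 => ?_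
    have h3 : (ℓ : ℤ) ∣ 1 := by
      simpa using dvd_sub (Int.natCast_dvd.2 h2) (h ℓ hℓ (by simpa using h1)).1
    exact hℓ.one_lt.ne' (by exact_mod_cast Int.eq_one_of_dvd_one (by positivity) h3)
  let φ : Fin n → ZMod n := fun k => (((fun x : ℤ => s * x + c)^[k] 0 : ℤ) : ZMod n)
  have hφ : Function.Injective φ := by
    have aux : ∀ a b : Fin n, a ≤ b → φ a = φ b → a = b := by
      intro a b hab heq
      have h1 : (n : ℤ) ∣ (fun x : ℤ => s * x + c)^[b] 0 - (fun x : ℤ => s * x + c)^[a] 0 :=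
        ((ZMod.intCast_eq_intCast_iff _ _ _).1 heq).dvd
      obtain ⟨d, hd⟩ := Nat.exists_eq_add_of_le (Fin.le_def.1 hab)
      -- The difference of the two iterates is `c * s ^ a` times a geometric sum of length `d`, and
      -- `c`, `s` are units modulo `n`.
      rw [hd, affine_iterate, affine_iterate, mul_zero, mul_zero, zero_add, zero_add, ← mul_sub,
        Finset.sum_range_add, add_sub_cancel_left] at h1
      simp_rw [pow_add, ← Finset.mul_sum] at h1
      have h2 := dvd_of_dvd_geom_sum (fun ℓ hℓ hd => (h ℓ hℓ hd).1) h4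
        ((hs.pow_right).dvd_of_dvd_mul_left (hc.dvd_of_dvd_mul_left h1))
      have h3 : d = 0 := Nat.eq_zero_of_dvd_of_lt h2 (by omega)
      exact Fin.ext (by omega)
    intro a b heq
    rcases le_total a b with hab | hab
    · exact aux a b hab heq
    · exact (aux b a hab heq.symm).symm
  have hsurj := ((Fintype.bijective_iff_injective_and_card φ).2 ⟨hφ, by simp⟩).2
  obtain ⟨k, hk⟩ := hsurj (j : ZMod n)
  exact ⟨k, (ZMod.intCast_eq_intCast_iff _ _ _).1 hk⟩

/-! ### Affine maps with two cycles -/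

/-- A set `A` of integers with group of periods `nℤ`, such that `i ↦ s * i + c` has exactly two
cycles modulo `n`, given by `A` and its complement. -/
structure IsTwoCycleSet (A : Set ℤ) (n : ℕ) (s c : ℤ) : Prop where
  pos : 0 < n
  period : ∀ t : ℤ, (∀ i, i + t ∈ A ↔ i ∈ A) ↔ (n : ℤ) ∣ t
  invariant : ∀ i, s * i + c ∈ A ↔ i ∈ A
  transitive : ∀ i j, (i ∈ A ↔ j ∈ A) → ∃ k : ℕ, (fun x : ℤ => s * x + c)^[k] i ≡ j [ZMOD n]
  nonempty : ∃ i, i ∈ A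
  nonempty_compl : ∃ i, i ∉ A

namespace IsTwoCycleSet

variable {A : Set ℤ} {n : ℕ} {s c : ℤ}

theorem mem_iff_of_modEq (h : IsTwoCycleSet A n s c) {i j : ℤ} (hij : i ≡ j [ZMOD n]) :
    i ∈ A ↔ j ∈ A := by
  have := (h.period (j - i)).2 hij.dvd i
  rw [← this]
  simp

theorem iterate_mem (h : IsTwoCycleSet A n s c) (k : ℕ) (i : ℤ) :
    (fun x : ℤ => s * x + c)^[k] i ∈ A ↔ i ∈ A := by
  induction k with
  | zero => rfl
  | succ k ih => rw [Function.iterate_succ_apply', h.invariant, ih]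

theorem compl (h : IsTwoCycleSet A n s c) : IsTwoCycleSet Aᶜ n s c where
  pos := h.pos
  period t := by
    rw [← h.period]
    exact forall_congr' fun i => not_iff_not
  invariant i := not_congr (h.invariant i)
  transitive i j hij := h.transitive i j (not_iff_not.1 hij)
  nonempty := h.nonempty_compl
  nonempty_compl := by simpa using h.nonempty

theorem ne_one (h : IsTwoCycleSet A n s c) : n ≠ 1 := by
  rintro rfl
  obtain ⟨i, hi⟩ := h.nonempty
  obtain ⟨j, hj⟩ := h.nonempty_compl
  exact hj ((h.mem_iff_of_modEq (by simpa using Int.modEq_one)).1 hi)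

/-- Modulo a proper divisor of `n`, the map is a single cycle. -/
theorem transitive_of_dvd (h : IsTwoCycleSet A n s c) {d : ℕ} (hd : d ∣ n) (hdn : d ≠ n)
    (i j : ℤ) : ∃ k : ℕ, (fun x : ℤ => s * x + c)^[k] i ≡ j [ZMOD d] := by
  by_contra hcon
  have hdz : (d : ℤ) ∣ n := Int.natCast_dvd_natCast.2 hd
  have hij : ¬ (i ∈ A ↔ j ∈ A) := fun hij => by
    obtain ⟨k, hk⟩ := h.transitive i j hij
    exact hcon ⟨k, hk.of_dvd hdz⟩
  refine hdn (Nat.dvd_antisymm hd (Int.natCast_dvd_natCast.1 ((h.period d).1 fun x => ?_)))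
  -- If `y ≡ z` lay on different sides, one could go from `i` to `y`, jump to `z` and go on to `j`,
  -- all modulo `d`. Hence `d` is a period of `A`.
  have key : ∀ y z : ℤ, y ≡ z [ZMOD d] → (i ∈ A ↔ y ∈ A) → (i ∈ A ↔ z ∈ A) := by
    intro y z hyz hy
    by_contra hz
    have hzj : z ∈ A ↔ j ∈ A := by tauto
    obtain ⟨k, hk⟩ := h.transitive i y hy
    obtain ⟨l, hl⟩ := h.transitive z j hzj
    refine hcon ⟨l + k, ?_⟩
    rw [Function.iterate_add_apply]
    exact (affine_iterate_modEq ((hk.of_dvd hdz).trans hyz) l).trans (hl.of_dvd hdz)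
  have e1 : x + d ≡ x [ZMOD d] := by simp
  have k1 := key _ _ e1
  have k2 := key _ _ e1.symm
  tauto

/-- A fixed point modulo `d` would be the whole of the single cycle there, leaving `i + 1`
unreachable. -/
theorem not_dvd_sub_of_dvd (h : IsTwoCycleSet A n s c) {d : ℕ} (hd : d ∣ n) (hdn : d ≠ n) (hd1 : d ≠ 1)
    (i : ℤ) : ¬ (d : ℤ) ∣ s * i + c - i := by
  intro hi
  obtain ⟨k, hk⟩ := h.transitive_of_dvd hd hdn i (i + 1)
  have hfix : ∀ k : ℕ, (fun x : ℤ => s * x + c)^[k] i ≡ i [ZMOD d] := by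
    intro k
    induction k with
    | zero => rfl
    | succ k ih =>
      rw [Function.iterate_succ_apply]
      exact (affine_iterate_modEq (Int.modEq_iff_dvd.2 hi).symm k).trans ih
  have := ((hfix k).symm.trans hk).dvd
  rw [add_sub_cancel_left] at this
  exact hd1 (by exact_mod_cast Int.eq_one_of_dvd_one (by positivity) this)

/-- The fixed point is a whole cycle, so it is all of `A`. It stays fixed modulo every divisor of
`n`, which rules out divisors other than 1 and `n`. Centred at the fixed point, the map is
multiplication by `s`, and its other cycle consists of all nonzero residues. -/
theorem of_fixed (h : IsTwoCycleSet A n s c) {i₀ : ℤ} (hi₀ : i₀ ∈ A)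
    (hfix : (n : ℤ) ∣ s * i₀ + c - i₀) :
    n.Prime ∧ (∀ i, i ∈ A ↔ i ≡ i₀ [ZMOD n]) ∧
      ∀ t : ℤ, ¬ (n : ℤ) ∣ t → ∃ k : ℕ, s ^ k ≡ t [ZMOD n] := by
  have hfix' : ∀ k : ℕ, (fun x : ℤ => s * x + c)^[k] i₀ ≡ i₀ [ZMOD n] := by
    intro k
    induction k with
    | zero => rfl
    | succ k ih =>
      rw [Function.iterate_succ_apply]
      exact (affine_iterate_modEq (Int.modEq_iff_dvd.2 hfix).symm k).trans ih
  have hA : ∀ i, i ∈ A ↔ i ≡ i₀ [ZMOD n] := by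
    intro i
    refine ⟨fun hi => ?_, fun hi => (h.mem_iff_of_modEq hi).2 hi₀⟩
    obtain ⟨k, hk⟩ := h.transitive i₀ i (by tauto)
    exact hk.symm.trans (hfix' k)
  refine ⟨?_, hA, fun t ht => ?_⟩
  · rw [Nat.prime_def]
    refine ⟨by have := h.pos; have := h.ne_one; omega, fun d hd => ?_⟩
    by_contra hcon
    push Not at hcon
    exact h.not_dvd_sub_of_dvd hd hcon.2 hcon.1 i₀ ((Int.natCast_dvd_natCast.2 hd).trans hfix)
  · have mem1 : i₀ + 1 ∉ A := by
      rw [hA]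
      intro h1
      have := h1.symm.dvd
      rw [add_sub_cancel_left] at this
      exact h.ne_one (by exact_mod_cast Int.eq_one_of_dvd_one (by positivity) this)
    have memt : i₀ + t ∉ A := by
      rw [hA]
      intro h1
      have := h1.symm.dvd
      rw [add_sub_cancel_left] at this
      exact ht this
    obtain ⟨k, hk⟩ := h.transitive _ _ (iff_of_false mem1 memt)
    refine ⟨k, ?_⟩
    have h2 := hk.sub (hfix' k)
    rw [affine_iterate, affine_iterate] at h2
    ring_nf at h2
    exact h2

/-- Having no fixed point modulo a prime `ℓ ∣ n` forces `s ≡ 1` and `c ≢ 0` modulo `ℓ`. As there are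
two cycles, Hull–Dobell must fail at 4, so `4 ∣ n`, `s ≡ 3` and `c` is odd. Modulo 4 the map is then
the involution `i ↦ c - i`, not a single cycle, so 4 is not a proper divisor of `n`. -/
theorem of_not_fixed (h : IsTwoCycleSet A n s c) (hfix : ∀ i, ¬ (n : ℤ) ∣ s * i + c - i) :
    n = 4 ∧ s % 4 = 3 ∧ ∃ j : ℤ, ∀ i, i ∈ A ↔ i ≡ j [ZMOD 4] ∨ i ≡ j + 1 [ZMOD 4] := by
  have hprime : ∀ ℓ : ℕ, ℓ.Prime → ℓ ∣ n → (ℓ : ℤ) ∣ s - 1 ∧ ¬ (ℓ : ℤ) ∣ c := by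
    intro ℓ hℓ hℓn
    have hnofix : ∀ i, ¬ (ℓ : ℤ) ∣ s * i + c - i := by
      by_cases hn : ℓ = n
      · rw [hn]
        exact hfix
      · exact h.not_dvd_sub_of_dvd hℓn hn hℓ.ne_one
    have h1 : (ℓ : ℤ) ∣ s - 1 := by
      by_contra h1
      have hcop := (Prime.coprime_iff_not_dvd (Nat.prime_iff_prime_int.1 hℓ)).2 h1
      obtain ⟨u, v, huv⟩ := hcop
      -- With `v` inverse to `s - 1` modulo `ℓ`, this solves `(s - 1) * i + c ≡ 0`.
      refine hnofix (-v * c) ⟨c * u, ?_⟩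
      linear_combination -c * huv
    refine ⟨h1, fun h2 => hnofix 0 ?_⟩
    simpa using h2
  have h4 : 4 ∣ n ∧ ¬ (4 : ℤ) ∣ s - 1 := by
    by_contra hcon
    have h4' : 4 ∣ n → (4 : ℤ) ∣ s - 1 := by tauto
    have hall : ∀ j, j ∈ A ↔ (0 : ℤ) ∈ A := by
      intro j
      obtain ⟨k, hk⟩ := exists_affine_iterate_modEq h.pos hprime h4' j
      rw [← h.mem_iff_of_modEq hk, h.iterate_mem]
    obtain ⟨i, hi⟩ := h.nonempty
    obtain ⟨j, hj⟩ := h.nonempty_compl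
    exact hj ((hall j).2 ((hall i).1 hi))
  have h2 := hprime 2 Nat.prime_two ((by norm_num : 2 ∣ 4).trans h4.1)
  push_cast at h2
  have hs : s % 4 = 3 := by omega
  have hsq : ∀ i : ℤ, s * (s * i + c) + c ≡ i [ZMOD 4] := by
    intro i
    obtain ⟨m, hm⟩ : ∃ m, s = 4 * m + 3 := ⟨s / 4, by omega⟩
    subst hm
    refine Int.modEq_iff_dvd.2 ⟨-(m * (4 * m + 3) * i + 3 * m * i + 2 * i + m * c + c), ?_⟩
    ring
  have hn : n = 4 := by
    by_contra hn
    have key := h.transitive_of_dvd h4.1 (Ne.symm hn) 0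
    have hit : ∀ k : ℕ, (fun x : ℤ => s * x + c)^[k] 0 ≡ 0 [ZMOD 4] ∨
        (fun x : ℤ => s * x + c)^[k] 0 ≡ c [ZMOD 4] := by
      intro k
      induction k with
      | zero => left; rfl
      | succ k ih =>
        rw [Function.iterate_succ_apply']
        rcases ih with ih | ih
        · right
          simpa using (ih.mul_left s).add_right c
        · left
          have := (ih.mul_left s).add_right c
          simpa using this.trans (by simpa using hsq 0)
    -- The orbit of 0 modulo 4 lies in `{0, c}`. Reaching `c + 1` forces `c ≡ 3`, and then `c + 2 ≡
    -- 1` is missed.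
    obtain ⟨k, hk⟩ := key (c + 1)
    rcases hit k with h5 | h5
    · obtain ⟨k', hk'⟩ := key (c + 2)
      have := hk'.dvd
      have h1 := hk.dvd
      have h3 := h5.dvd
      rcases hit k' with h6 | h6 <;> have h7 := h6.dvd <;> omega
    · have h1 := hk.dvd
      have h3 := h5.dvd
      omega
  subst hn
  refine ⟨rfl, hs, ?_⟩
  obtain ⟨m, hm⟩ : ∃ m, s = 4 * m + 3 := ⟨s / 4, by omega⟩
  have hodd : c % 4 = 1 ∨ c % 4 = 3 := by omega
  obtain ⟨a, ha⟩ := h.nonempty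
  have hfa : ∀ i, s * i + c ≡ c - i [ZMOD 4] := fun i => by
    subst hm
    exact Int.modEq_iff_dvd.2 ⟨-(m * i + i), by ring⟩
  have hA : ∀ i, i ∈ A ↔ i ≡ a [ZMOD 4] ∨ i ≡ c - a [ZMOD 4] := by
    intro i
    constructor
    · intro hi
      obtain ⟨k, hk⟩ := h.transitive a i (by tauto)
      have hit : ∀ k : ℕ, (fun x : ℤ => s * x + c)^[k] a ≡ a [ZMOD 4] ∨
          (fun x : ℤ => s * x + c)^[k] a ≡ c - a [ZMOD 4] := by
        intro k
        induction k with
        | zero => left; rfl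
        | succ k ih =>
          rw [Function.iterate_succ_apply']
          rcases ih with ih | ih
          · right
            exact ((ih.mul_left s).add_right c).trans (hfa a)
          · left
            have := ((ih.mul_left s).add_right c).trans (hfa (c - a))
            simpa using this
      rcases hit k with h5 | h5
      · left
        exact hk.symm.trans h5
      · right
        exact hk.symm.trans h5
    · rintro (hi | hi)
      · exact (h.mem_iff_of_modEq hi).2 ha
      · rw [h.mem_iff_of_modEq (hi.trans (hfa a).symm), h.invariant]
        exact ha
  -- The classes `a` and `c - a` differ by an odd number, so they are consecutive in one of the two
  -- orders.
  have : (c - 2 * a) % 4 = 1 ∨ (c - 2 * a) % 4 = 3 := by omega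
  simp only [Int.ModEq] at hA ⊢
  rcases this with h5 | h5
  · refine ⟨a, fun i => (hA i).trans ?_⟩
    rw [show (c - a) % 4 = (a + 1) % 4 by omega]
  · refine ⟨c - a, fun i => (hA i).trans ?_⟩
    rw [show (c - a + 1) % 4 = a % 4 by omega]
    tauto

end IsTwoCycleSet

/-! ### Rank three groups and their orbits on pairs -/

section AffineSemilinear

variable {F : Type*} [Field F]

/-- The affine semilinear permutation `x ↦ a * σ x + b`. -/
def affineSemilinearPerm (a : Fˣ) (σ : F ≃+* F) (b : F) : Equiv.Perm F :=
  σ.toEquiv.trans ((Units.mulLeft a).trans (Equiv.addRight b))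

@[simp]
theorem affineSemilinearPerm_apply (a : Fˣ) (σ : F ≃+* F) (b x : F) :
    affineSemilinearPerm a σ b x = a * σ x + b := rfl

theorem affineSemilinearPerm_mem (a : Fˣ) (σ : F ≃+* F) (b : F) :
    affineSemilinearPerm a σ b ∈ affineSemilinearGroup F := ⟨a, σ, b, fun _ => rfl⟩

open Classical in
/-- A pair of points is sorted according to equality, adjacency, and nonadjacency. -/
noncomputable def pairType {V : Type*} (Γ : SimpleGraph V) (z : V × V) : Fin 3 :=
  if z.1 = z.2 then 0 else if Γ.Adj z.1 z.2 then 1 else 2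

theorem pairType_smul {V : Type*} {Γ : SimpleGraph V} {G : Subgroup (Equiv.Perm V)}
    (hG : G ≤ graphAut Γ) (g : G) (z : V × V) : pairType Γ (g • z) = pairType Γ z := by
  obtain ⟨x, y⟩ := z
  change pairType Γ ((g : Equiv.Perm V) x, (g : Equiv.Perm V) y) = _
  have h := hG g.2 x y
  by_cases hxy : x = y
  · simp [pairType, hxy]
  · by_cases hadj : Γ.Adj x y <;> simp [pairType, hxy, h, hadj]

/-- The type of a pair of points, as a function of its orbit. -/
noncomputable def orbitPairType {V : Type*} {Γ : SimpleGraph V} {G : Subgroup (Equiv.Perm V)}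
    (hG : G ≤ graphAut Γ) : MulAction.orbitRel.Quotient G (V × V) → Fin 3 :=
  Quotient.lift (pairType Γ) (by
    rintro a b ⟨g, rfl⟩
    exact pairType_smul hG g b)

/-- A rank three group of automorphisms is transitive on the pairs of a given type, provided that
all types occur. -/
theorem exists_smul_eq_of_pairType_eq {V : Type*} {Γ : SimpleGraph V}
    {G : Subgroup (Equiv.Perm V)} (hG : G ≤ graphAut Γ)
    (h3 : Nat.card (MulAction.orbitRel.Quotient G (V × V)) = 3)
    (hsurj : Function.Surjective (pairType Γ)) {z w : V × V} (hzw : pairType Γ z = pairType Γ w) :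
    ∃ g ∈ G, g z.1 = w.1 ∧ g z.2 = w.2 := by
  have : Finite (MulAction.orbitRel.Quotient G (V × V)) := Nat.finite_of_card_ne_zero (by omega)
  have hs : Function.Surjective (orbitPairType hG) := fun i => by
    obtain ⟨z, hz⟩ := hsurj i
    exact ⟨Quotient.mk _ z, hz⟩
  have hb := (Nat.bijective_iff_surjective_and_card (orbitPairType hG)).2 ⟨hs, by simp [h3]⟩
  have heq : (Quotient.mk _ w : MulAction.orbitRel.Quotient G (V × V)) = Quotient.mk _ z :=
    hb.1 hzw.symm
  obtain ⟨g, hg⟩ := Quotient.exact heq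
  exact ⟨g, g.2, congrArg Prod.fst hg, congrArg Prod.snd hg⟩

/-- The one-dimensional affine group is doubly transitive. -/
theorem exists_affineSemilinearGroup_apply_eq {x y x' y' : F} (h : x ≠ y) (h' : x' ≠ y') :
    ∃ g ∈ affineSemilinearGroup F, g x = x' ∧ g y = y' := by
  have h1 : y - x ≠ 0 := sub_ne_zero.2 h.symm
  have h2 : y' - x' ≠ 0 := sub_ne_zero.2 h'.symm
  refine ⟨affineSemilinearPerm (Units.mk0 _ (div_ne_zero h2 h1)) (RingEquiv.refl F)
    (x' - (y' - x') / (y - x) * x), affineSemilinearPerm_mem _ _ _, ?_, ?_⟩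
  · simp
  · simp
    field_simp
    ring

/-- Otherwise the group is the full affine semilinear group, which is doubly transitive and so has
fewer than three orbits on pairs. -/
theorem IsAffineRankThreeGraph.ne_of_graphAut_eq_top {Γ : SimpleGraph F}
    (h : IsAffineRankThreeGraph Γ) : graphAut Γ ≠ ⊤ := by
  intro htop
  have h3 := h.2
  rw [htop, top_inf_eq] at h3
  have hinj : Function.Injective
      (orbitPairType (Γ := (⊤ : SimpleGraph F)) (G := affineSemilinearGroup F)
        (fun g _ x y => by simp)) := by
    intro a b
    induction a using Quotient.inductionOn with | _ z
    induction b using Quotient.inductionOn with | _ w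
    intro hzw
    change pairType ⊤ z = pairType ⊤ w at hzw
    apply Quotient.sound
    by_cases hz : z.1 = z.2 <;> by_cases hw : w.1 = w.2
    · refine ⟨⟨affineSemilinearPerm 1 (RingEquiv.refl F) (z.1 - w.1),
        affineSemilinearPerm_mem _ _ _⟩, Prod.ext ?_ ?_⟩
      · change affineSemilinearPerm 1 (RingEquiv.refl F) (z.1 - w.1) w.1 = z.1
        simp
      · change affineSemilinearPerm 1 (RingEquiv.refl F) (z.1 - w.1) w.2 = z.2
        simp [← hz, ← hw]
    · simp [pairType, hz, hw] at hzw
    · simp [pairType, hz, hw] at hzw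
    · obtain ⟨g, hg, h1, h2⟩ := exists_affineSemilinearGroup_apply_eq hw hz
      exact ⟨⟨g, hg⟩, Prod.ext h1 h2⟩
  have : Finite (MulAction.orbitRel.Quotient (affineSemilinearGroup F) (F × F)) :=
    Nat.finite_of_card_ne_zero (by omega)
  have hb := (Nat.bijective_iff_injective_and_card _).2 ⟨hinj, by simp [h3]⟩
  obtain ⟨a, ha⟩ := hb.2 2
  induction a using Quotient.inductionOn with | _ z
  change pairType ⊤ z = 2 at ha
  by_cases hz : z.1 = z.2 <;> simp [pairType, hz] at ha

/-- An affine rank three graph is neither complete nor empty. -/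
theorem IsAffineRankThreeGraph.pairType_surjective {Γ : SimpleGraph F}
    (h : IsAffineRankThreeGraph Γ) : Function.Surjective (pairType Γ) := by
  have hadj : ∃ x y, Γ.Adj x y := by
    by_contra! hcon
    refine h.ne_of_graphAut_eq_top (eq_top_iff.2 fun g _ x y => ?_)
    simp [hcon]
  have hnadj : ∃ x y, x ≠ y ∧ ¬ Γ.Adj x y := by
    by_contra! hcon
    refine h.ne_of_graphAut_eq_top (eq_top_iff.2 fun g _ x y => ?_)
    have key : ∀ x y, Γ.Adj x y ↔ x ≠ y := fun x y => ⟨fun h => h.ne, hcon x y⟩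
    simp [key]
  obtain ⟨x, y, hxy⟩ := hadj
  obtain ⟨x', y', hne, hxy'⟩ := hnadj
  intro i
  fin_cases i
  · exact ⟨(x, x), by simp [pairType]⟩
  · exact ⟨(x, y), by simp [pairType, hxy, hxy.ne]⟩
  · exact ⟨(x', y'), by simp [pairType, hxy', hne]⟩

/-- The three orbits are equality, adjacency and nonadjacency. This is the form in which rank three
is used from here on. -/
theorem IsAffineRankThreeGraph.exists_mem_apply_eq {Γ : SimpleGraph F}
    (h : IsAffineRankThreeGraph Γ) {x y x' y' : F} (hxy : x ≠ y) (hxy' : x' ≠ y')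
    (hadj : Γ.Adj x y ↔ Γ.Adj x' y') :
    ∃ g ∈ graphAut Γ ⊓ affineSemilinearGroup F, g x = x' ∧ g y = y' :=
  exists_smul_eq_of_pairType_eq inf_le_left h.2 h.pairType_surjective (z := (x, y)) (w := (x', y'))
    (by by_cases hc : Γ.Adj x y <;> have hc' := hc <;> rw [hadj] at hc' <;>
      simp [pairType, hxy, hxy', hc, hc'])

theorem ringEquiv_eq_of_apply_generator {ω : Fˣ} (hω : ∀ u : Fˣ, u ∈ Subgroup.zpowers ω)
    {σ τ : F ≃+* F} (h : σ ω = τ ω) : σ = τ := by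
  ext x
  by_cases hx : x = 0
  · simp [hx]
  obtain ⟨k, hk⟩ := hω (Units.mk0 x hx)
  have hk' : x = (ω : F) ^ k := by
    rw [← Units.val_zpow_eq_zpow_val]
    exact (congrArg Units.val hk).symm
  rw [hk', map_zpow₀, map_zpow₀, h]

/-! ### Translations -/

/-- A transitive group of affine semilinear maps of a finite field contains a nontrivial
translation. -/
theorem exists_addRight_mem [Finite F] {G : Subgroup (Equiv.Perm F)}
    (hG : G ≤ affineSemilinearGroup F) [MulAction.IsPretransitive G F] :
    ∃ b : F, b ≠ 0 ∧ Equiv.addRight b ∈ G := by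
  have : Fintype F := Fintype.ofFinite F
  obtain ⟨p, _, n, hp, hcard⟩ := FiniteField.card' F
  have : Fact p.Prime := ⟨hp⟩
  have hdvd : p ^ (n : ℕ) ∣ Nat.card G := by
    rw [← hcard, ← Nat.card_eq_fintype_card, ← MulAction.index_stabilizer_of_transitive G (0 : F)]
    exact Subgroup.index_dvd_card _
  obtain ⟨P, hP⟩ := Sylow.exists_subgroup_card_pow_prime p hdvd
  have hPF : Nat.card P = Nat.card F := by rw [hP, Nat.card_eq_fintype_card, hcard]
  have hrep : ∀ g : P, ∃ (a : Fˣ) (σ : F ≃+* F) (b : F), ∀ x, (g : Equiv.Perm F) x = a * σ x + b :=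
    fun g => hG g.1.2
  choose a σ b hg using hrep
  obtain ⟨ω, hω⟩ := IsCyclic.exists_generator (α := Fˣ)
  -- The `q` elements of `P` send `ω` to nonzero values only, so two of them share a field
  -- automorphism, and their quotient is affine over `F`.
  have hninj : ¬ Function.Injective fun g : P => σ g ω := fun hinj => by
    obtain ⟨g, h0⟩ := ((Nat.bijective_iff_injective_and_card _).2 ⟨hinj, hPF⟩).2 0
    exact ω.ne_zero ((map_eq_zero _).1 h0)
  simp only [Function.Injective, not_forall] at hninj
  obtain ⟨g₁, g₂, heq, hne⟩ := hninj
  have hσ := ringEquiv_eq_of_apply_generator hω heq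
  set g : P := g₂ * g₁⁻¹ with hgdef
  set α : F := a g₂ / a g₁ with hα
  have hgx : ∀ x, ((g : G) : Equiv.Perm F) x = α * x + (b g₂ - α * b g₁) := by
    intro x
    obtain ⟨z, rfl⟩ := ((g₁ : G) : Equiv.Perm F).surjective x
    have e : ((g : G) : Equiv.Perm F) (((g₁ : G) : Equiv.Perm F) z) =
        ((g₂ : G) : Equiv.Perm F) z := by
      simp [hgdef]
    rw [e, hg, hg, hσ, hα]
    field_simp
    ring
  have hit : ∀ k : ℕ, ∃ c, ∀ x, (((g : G) : Equiv.Perm F) ^ k) x = α ^ k * x + c := by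
    intro k
    induction k with
    | zero => exact ⟨0, fun x => by simp⟩
    | succ k ih =>
      obtain ⟨c, hc⟩ := ih
      refine ⟨α * c + (b g₂ - α * b g₁), fun x => ?_⟩
      rw [pow_succ', Equiv.Perm.mul_apply, hc, hgx]
      ring
  -- The order of `g` divides `q`, so `α ^ q = 1`, while `α ^ q = α` in a field of `q` elements.
  have hα1 : α = 1 := by
    obtain ⟨c, hc⟩ := hit (Nat.card P)
    have h1 : (((g : G) : Equiv.Perm F) ^ Nat.card P) = 1 := by
      rw [← Subgroup.coe_pow, ← Subgroup.coe_pow, pow_card_eq_one']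
      rfl
    rw [h1, hPF, Nat.card_eq_fintype_card, FiniteField.pow_card] at hc
    have h2 := hc 0
    have h3 := hc 1
    simp at h2 h3
    rw [← h2] at h3
    simpa using h3.symm
  refine ⟨b g₂ - α * b g₁, fun h0 => hne ?_, ?_⟩
  · have : g = 1 := by
      ext x
      rw [hgx, h0, hα1]
      simp
    exact (mul_inv_eq_one.1 this).symm
  · convert (g : G).2 using 1
    ext x
    rw [hgx, hα1]
    simp

/-- Affine rank three graphs are invariant under translations. -/
theorem IsAffineRankThreeGraph.adj_add_right_iff [Finite F] {Γ : SimpleGraph F}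
    (h : IsAffineRankThreeGraph Γ) (b x y : F) : Γ.Adj (x + b) (y + b) ↔ Γ.Adj x y := by
  have := h.1
  obtain ⟨b₀, hb₀, hmem⟩ := exists_addRight_mem (inf_le_right : graphAut Γ ⊓ _ ≤ _)
  let U : Set F := {u | Equiv.addRight u ∈ graphAut Γ}
  have hU0 : (0 : F) ∈ U := by
    change Equiv.addRight (0 : F) ∈ graphAut Γ
    simp [(graphAut Γ).one_mem]
  have hb₀U : b₀ - 0 ∈ U := by
    rw [sub_zero]
    exact hmem.1
  -- Conjugating the translation by `z - w` with `g` gives the translation by `g z - g w`.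
  have hU : ∀ g ∈ graphAut Γ ⊓ affineSemilinearGroup F, ∀ z w, z - w ∈ U → g z - g w ∈ U := by
    rintro g ⟨hg, hg'⟩ z w hu
    obtain ⟨a, σ, c, hgx⟩ := id hg'
    change Equiv.addRight (g z - g w) ∈ graphAut Γ
    convert (graphAut Γ).mul_mem ((graphAut Γ).mul_mem hg hu) ((graphAut Γ).inv_mem hg) using 1
    ext x
    obtain ⟨v, rfl⟩ := g.surjective x
    have e : g⁻¹ (g v) = v := g.symm_apply_apply v
    rw [Equiv.Perm.mul_apply, Equiv.Perm.mul_apply, e]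
    simp [hgx]
    ring
  by_cases hall : ∀ u, u ∈ U
  · exact hall b x y
  push Not at hall
  obtain ⟨u₁, hu₁⟩ := hall
  have hu₁0 : u₁ ≠ 0 := fun h0 => hu₁ (h0 ▸ hU0)
  -- If some translation is missing, membership of the difference in `U` separates adjacency from
  -- nonadjacency. Adjacency then depends on differences only, so translations preserve it after
  -- all.
  have key : ∀ z w, z ≠ w → ((Γ.Adj z w ↔ Γ.Adj 0 b₀) ↔ w - z ∈ U) := by
    intro z w hzw
    constructor
    · intro hadj
      obtain ⟨g, hg, h1, h2⟩ := h.exists_mem_apply_eq hb₀.symm hzw hadj.symm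
      rw [← h1, ← h2]
      exact hU g hg _ _ hb₀U
    · intro hmem'
      by_contra hcon
      have hb : ¬ (Γ.Adj 0 u₁ ↔ Γ.Adj 0 b₀) := fun hb => by
        obtain ⟨g, hg, h1, h2⟩ := h.exists_mem_apply_eq hb₀.symm hu₁0.symm hb.symm
        apply hu₁
        have := hU g hg b₀ 0 hb₀U
        rwa [h1, h2, sub_zero] at this
      obtain ⟨g, hg, h1, h2⟩ := h.exists_mem_apply_eq hzw hu₁0.symm (by tauto)
      apply hu₁
      have := hU g hg _ _ hmem'
      rwa [h1, h2, sub_zero] at this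
  by_cases hxy : x = y
  · simp [hxy]
  have k1 := key x y hxy
  have k2 := key (x + b) (y + b) (by simpa using hxy)
  rw [add_sub_add_right_eq_sub] at k2
  tauto

/-! ### Field automorphisms and the action on exponents -/

/-- Every automorphism of a finite field is a power of the Frobenius automorphism. -/
theorem ringEquiv_eq_pow [Finite F] (p : ℕ) [Fact p.Prime] [CharP F p] (σ : F ≃+* F) :
    ∃ t : ℕ, ∀ x, σ x = x ^ p ^ t := by
  let _ := ZMod.algebra F p
  let τ : Gal(F/ZMod p) := AlgEquiv.ofRingEquiv (f := σ) fun x =>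
    RingHom.congr_fun (Subsingleton.elim ((σ : F →+* F).comp (algebraMap (ZMod p) F))
      (algebraMap (ZMod p) F)) x
  obtain ⟨t, ht⟩ := (FiniteField.bijective_frobeniusAlgEquivOfAlgebraic_pow (ZMod p) F).2 τ
  refine ⟨t, fun x => ?_⟩
  have h1 : σ x = (FiniteField.frobeniusAlgEquivOfAlgebraic (ZMod p) F ^ (t : ℕ)) x := by
    rw [show FiniteField.frobeniusAlgEquivOfAlgebraic (ZMod p) F ^ (t : ℕ) = τ from ht]
    rfl
  rw [h1, AlgEquiv.coe_pow, FiniteField.coe_frobeniusAlgEquivOfAlgebraic_iterate, ZMod.card]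

/-- Frobenius generates. Cyclicity passes to `graphFieldAut Γ`, so that a single affine map on
exponents carries the whole action. -/
theorem isCyclic_ringEquiv [Finite F] : IsCyclic (F ≃+* F) := by
  obtain ⟨p, hp⟩ := CharP.exists F
  have : Fact p.Prime := ⟨CharP.char_is_prime F p⟩
  refine ⟨frobeniusEquiv F p, fun σ => ?_⟩
  obtain ⟨t, ht⟩ := ringEquiv_eq_pow p σ
  refine ⟨t, ?_⟩
  have key : ∀ (t : ℕ) (x : F), (frobeniusEquiv F p ^ t) x = x ^ p ^ t := by
    intro t
    induction t with
    | zero => simp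
    | succ t ih =>
      intro x
      rw [pow_succ', RingAut.mul_apply, ih, frobeniusEquiv_apply, frobenius_def, ← pow_mul,
        ← pow_succ]
  ext x
  simp [key, ht]

/-- The field automorphisms occurring in semilinear automorphisms of a graph. -/
def graphFieldAut (Γ : SimpleGraph F) : Subgroup (F ≃+* F) where
  carrier := {σ | ∃ a : Fˣ, affineSemilinearPerm a σ 0 ∈ graphAut Γ}
  mul_mem' := by
    rintro σ τ ⟨a, ha⟩ ⟨b, hb⟩
    refine ⟨a * Units.map (σ : F →* F) b, ?_⟩
    convert (graphAut Γ).mul_mem ha hb using 1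
    ext x
    simp [RingAut.mul_apply, mul_assoc]
  one_mem' := by
    refine ⟨1, ?_⟩
    convert (graphAut Γ).one_mem using 1
    ext x
    simp
  inv_mem' := by
    rintro σ ⟨a, ha⟩
    refine ⟨Units.map (σ.symm : F →* F) a⁻¹, ?_⟩
    convert (graphAut Γ).inv_mem ha using 1
    rw [eq_inv_iff_mul_eq_one]
    ext x
    have e : (σ⁻¹ : F ≃+* F) = σ.symm := rfl
    simp [e]

/-- The exponents of the neighbours of `0`. -/
def neighborExponents (Γ : SimpleGraph F) (ω : Fˣ) : Set ℤ :=
  {i | Γ.Adj 0 ((ω ^ i : Fˣ) : F)}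

theorem exists_eq_zpow_of_forall_mem_zpowers {ω : Fˣ} (hω : ∀ u : Fˣ, u ∈ Subgroup.zpowers ω)
    {x : F} (hx : x ≠ 0) : ∃ i : ℤ, x = ((ω ^ i : Fˣ) : F) := by
  obtain ⟨k, hk⟩ := hω (Units.mk0 x hx)
  exact ⟨k, (congrArg Units.val hk).symm⟩

/-- The arithmetical content of the rank three property. -/
theorem IsAffineRankThreeGraph.exists_isTwoCycleSet [Finite F] {Γ : SimpleGraph F}
    (h : IsAffineRankThreeGraph Γ) (p : ℕ) [Fact p.Prime] [CharP F p] {ω : Fˣ}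
    (hω : ∀ u : Fˣ, u ∈ Subgroup.zpowers ω) :
    ∃ (n t : ℕ) (c : ℤ), n ∣ Nat.card Fˣ ∧
      IsTwoCycleSet (neighborExponents Γ ω) n ((p ^ t : ℕ) : ℤ) c := by
  have hord : orderOf ω = Nat.card Fˣ := orderOf_eq_card_of_forall_mem_zpowers hω
  let W : AddSubgroup ℤ :=
    { carrier := {t | ∀ i, i + t ∈ neighborExponents Γ ω ↔ i ∈ neighborExponents Γ ω}
      zero_mem' := fun i => by simp
      add_mem' := fun {a b} ha hb i => by rw [← add_assoc, hb, ha]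
      neg_mem' := fun {a} ha i => by rw [← ha (i + -a), neg_add_cancel_right] }
  obtain ⟨m, hm⟩ := Int.subgroup_cyclic W
  have hW : ∀ t, t ∈ W ↔ (m.natAbs : ℤ) ∣ t := fun t => by
    rw [hm, ← AddSubgroup.zmultiples_eq_closure, Int.mem_zmultiples_iff, Int.natAbs_dvd]
  set n := m.natAbs
  have hN : (Nat.card Fˣ : ℤ) ∈ W := fun i => by
    change Γ.Adj 0 _ ↔ Γ.Adj 0 _
    rw [zpow_add, ← hord, zpow_natCast, pow_orderOf_eq_one, mul_one]
  have hnN : n ∣ Nat.card Fˣ := Int.natCast_dvd_natCast.1 ((hW _).1 hN)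
  have : IsCyclic (F ≃+* F) := isCyclic_ringEquiv
  have : Finite (F ≃+* F) := Finite.of_injective (fun σ => (σ : F → F)) DFunLike.coe_injective
  -- By finiteness natural powers suffice, which matches forward iteration of the exponent map.
  obtain ⟨⟨σ, a, ha⟩, hσ⟩ := IsCyclic.exists_monoid_generator (α := graphFieldAut Γ)
  obtain ⟨t, ht⟩ := ringEquiv_eq_pow p σ
  obtain ⟨c, hc⟩ := hω a
  set e := affineSemilinearPerm a σ 0 with he
  have he0 : e 0 = 0 := by simp [he]
  have heω : ∀ i : ℤ, e ((ω ^ i : Fˣ) : F) = ((ω ^ (((p ^ t : ℕ) : ℤ) * i + c) : Fˣ) : F) := by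
    intro i
    have hc' : a = ω ^ c := hc.symm
    rw [he, affineSemilinearPerm_apply, ht, hc', add_zero, ← Units.val_pow_eq_pow_val,
      ← Units.val_mul, ← zpow_natCast, ← zpow_mul, ← zpow_add]
    congr 2
    ring
  have heit : ∀ (k : ℕ) (i : ℤ), (e ^ k) ((ω ^ i : Fˣ) : F) =
      ((ω ^ ((fun x : ℤ => ((p ^ t : ℕ) : ℤ) * x + c)^[k] i) : Fˣ) : F) := by
    intro k i
    induction k with
    | zero => rfl
    | succ k ih => rw [pow_succ', Equiv.Perm.mul_apply, ih, heω, Function.iterate_succ_apply']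
  have heform : ∀ k : ℕ, ∃ b : Fˣ, ∀ x, (e ^ k) x = b * (σ ^ k) x := by
    intro k
    induction k with
    | zero => exact ⟨1, fun x => by simp⟩
    | succ k ih =>
      obtain ⟨b, hb⟩ := ih
      refine ⟨a * Units.map (σ : F →* F) b, fun x => ?_⟩
      rw [pow_succ', Equiv.Perm.mul_apply, hb, pow_succ', RingAut.mul_apply]
      simp [he, mul_assoc]
  have hadj0 : ∀ g ∈ graphAut Γ, g 0 = 0 → ∀ x, Γ.Adj 0 (g x) ↔ Γ.Adj 0 x := by
    intro g hg hg0 x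
    have := hg 0 x
    rwa [hg0] at this
  have hek0 : ∀ k : ℕ, (e ^ k) 0 = 0 := fun k => by
    obtain ⟨b, hb⟩ := heform k
    simp [hb]
  refine ⟨n, t, c, hnN, ?_, hW, fun i => ?_, fun i j hij => ?_, ?_, ?_⟩
  · exact Nat.pos_of_dvd_of_pos hnN Nat.card_pos
  · change Γ.Adj 0 _ ↔ Γ.Adj 0 _
    rw [← heω]
    exact hadj0 e ha he0 _
  · obtain ⟨g, ⟨hg, hg'⟩, h1, h2⟩ := h.exists_mem_apply_eq (Units.ne_zero (ω ^ i)).symm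
      (Units.ne_zero (ω ^ j)).symm hij
    obtain ⟨b, τ, d, hgx⟩ := id hg'
    have hd : d = 0 := by simpa [hgx] using h1
    subst hd
    have hτ : τ ∈ graphFieldAut Γ := ⟨b, by
      have e1 : affineSemilinearPerm b τ 0 = g := by
        ext x
        rw [hgx, affineSemilinearPerm_apply]
      exact e1 ▸ hg⟩
    obtain ⟨k, hk⟩ := hσ ⟨τ, hτ⟩
    have hk' : σ ^ k = τ := congrArg Subtype.val hk
    obtain ⟨b', hb'⟩ := heform k
    obtain ⟨v, hv⟩ := hω (b * b'⁻¹)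
    have hv' : b * b'⁻¹ = ω ^ v := hv.symm
    have hgv : ∀ x, g x = ((ω ^ v : Fˣ) : F) * (e ^ k) x := by
      intro x
      rw [hgx, ← hv', hb', hk', ← mul_assoc, ← Units.val_mul, inv_mul_cancel_right, add_zero]
    refine ⟨k, ?_⟩
    -- `g` and `e ^ k` have the same field part and differ by the scalar `ω ^ v`. Both preserve the
    -- neighbours of `0`, so `v` is a period, invisible modulo `n`.
    have hvW : v ∈ W := by
      intro l
      change Γ.Adj 0 _ ↔ Γ.Adj 0 _
      obtain ⟨z, hz⟩ := (e ^ k).surjective ((ω ^ l : Fˣ) : F)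
      have e1 : ((ω ^ (l + v) : Fˣ) : F) = g z := by
        rw [hgv, hz, ← Units.val_mul, ← zpow_add, add_comm]
      rw [e1, ← hz, hadj0 g hg h1, hadj0 (e ^ k) ((graphAut Γ).pow_mem ha k) (hek0 k)]
    rw [hgv, heit, ← Units.val_mul, ← zpow_add, Units.val_inj, zpow_eq_zpow_iff_modEq, hord] at h2
    have h3 := h2.of_dvd (Int.natCast_dvd_natCast.2 hnN)
    refine Int.ModEq.trans ?_ h3
    exact Int.modEq_iff_dvd.2 (by simpa using (hW v).1 hvW)
  · obtain ⟨⟨x, y⟩, hxy⟩ := h.pairType_surjective 1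
    by_cases hne : x = y
    · simp [pairType, hne] at hxy
    have hadj : Γ.Adj x y := by
      by_contra hn
      simp [pairType, hne, hn] at hxy
    have h0 := (h.adj_add_right_iff (-x) x y).2 hadj
    obtain ⟨i, hi⟩ := exists_eq_zpow_of_forall_mem_zpowers hω
      (x := y + -x) (by rw [← sub_eq_add_neg]; exact sub_ne_zero.2 (Ne.symm hne))
    exact ⟨i, by rwa [add_neg_cancel, hi] at h0⟩
  · obtain ⟨⟨x, y⟩, hxy⟩ := h.pairType_surjective 2
    by_cases hne : x = y
    · simp [pairType, hne] at hxy
    have hadj : ¬ Γ.Adj x y := by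
      intro hn
      simp [pairType, hn.ne, hn] at hxy
    have h0 := (h.adj_add_right_iff (-x) x y).not.2 hadj
    obtain ⟨i, hi⟩ := exists_eq_zpow_of_forall_mem_zpowers hω
      (x := y + -x) (by rw [← sub_eq_add_neg]; exact sub_ne_zero.2 (Ne.symm hne))
    exact ⟨i, by rwa [add_neg_cancel, hi] at h0⟩

/-! ### Recognition of the graphs -/

/-- A translation invariant graph is, up to a scalar, the Cayley graph of any scalar multiple of
its neighbourhood of `0`. -/
theorem exists_isCayleyGraph {Γ : SimpleGraph F} (hΓ : ∀ b x y, Γ.Adj (x + b) (y + b) ↔ Γ.Adj x y)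
    {ω : Fˣ} (hω : ∀ u : Fˣ, u ∈ Subgroup.zpowers ω) (j : ℤ) {S : Set F} (h0 : (0 : F) ∉ S)
    (hS : ∀ i : ℤ, ((ω ^ i : Fˣ) : F) ∈ S ↔ i + j ∈ neighborExponents Γ ω) :
    ∃ Δ : SimpleGraph F, IsCayleyGraph Δ S ∧ IsScalarIsomorphic Γ Δ := by
  refine ⟨Γ.comap fun x => ((ω ^ j : Fˣ) : F) * x, fun x y => ?_, (ω ^ j)⁻¹,
    ⟨Units.mulLeft (ω ^ j)⁻¹, ?_⟩, fun x => rfl⟩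
  · rw [SimpleGraph.comap_adj, ← hΓ (-(((ω ^ j : Fˣ) : F) * x)), add_neg_cancel]
    by_cases hxy : y = x
    · simp [hxy, h0]
    · obtain ⟨i, hi⟩ := exists_eq_zpow_of_forall_mem_zpowers hω (sub_ne_zero.2 hxy)
      rw [hi, hS]
      have e : ((ω ^ j : Fˣ) : F) * y + -(((ω ^ j : Fˣ) : F) * x) = ((ω ^ (i + j) : Fˣ) : F) := by
        rw [add_comm i j, zpow_add, Units.val_mul, ← hi]
        ring
      rw [e]
      rfl
  · intro x y
    simp only [SimpleGraph.comap_adj, Units.mulLeft_apply, Units.mul_inv_cancel_left]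

theorem compl_adj_add_right_iff {Γ : SimpleGraph F}
    (hΓ : ∀ b x y, Γ.Adj (x + b) (y + b) ↔ Γ.Adj x y) (b x y : F) :
    Γᶜ.Adj (x + b) (y + b) ↔ Γᶜ.Adj x y := by
  simp [SimpleGraph.compl_adj, hΓ]

theorem neighborExponents_compl (Γ : SimpleGraph F) (ω : Fˣ) :
    neighborExponents Γᶜ ω = (neighborExponents Γ ω)ᶜ := by
  ext i
  have h0 : (0 : F) ≠ ((ω ^ i : Fˣ) : F) := (Units.ne_zero _).symm
  simp only [neighborExponents, SimpleGraph.compl_adj, Set.mem_ofPred_eq, Set.mem_compl_iff, ne_eq,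
    h0, not_false_eq_true, true_and]

theorem zpow_mem_zpowers_pow_iff {G : Type*} [Group G] {ω : G} {n : ℕ} (hn : n ∣ orderOf ω)
    (i : ℤ) : ω ^ i ∈ Subgroup.zpowers (ω ^ n) ↔ (n : ℤ) ∣ i := by
  rw [Subgroup.mem_zpowers_iff]
  constructor
  · rintro ⟨k, hk⟩
    rw [← zpow_natCast, ← zpow_mul, zpow_eq_zpow_iff_modEq] at hk
    exact (hk.of_dvd (Int.natCast_dvd_natCast.2 hn)).dvd_iff.1 (dvd_mul_right _ _)
  · rintro ⟨k, rfl⟩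
    exact ⟨k, by rw [← zpow_natCast, ← zpow_mul]⟩

/-- The order of `p` modulo `ℓ`, given that the powers of `p` exhaust the nonzero residues. -/
theorem orderOf_natCast_eq_sub_one {p ℓ : ℕ} (hℓ : ℓ.Prime) (hpℓ : p.Coprime ℓ)
    (h : ∀ t : ℤ, ¬ (ℓ : ℤ) ∣ t → ∃ k : ℕ, (p : ℤ) ^ k ≡ t [ZMOD ℓ]) :
    orderOf (p : ZMod ℓ) = ℓ - 1 := by
  have : Fact ℓ.Prime := ⟨hℓ⟩
  rw [← ZMod.coe_unitOfCoprime p hpℓ, orderOf_units, ← ZMod.card_units ℓ,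
    ← Nat.card_eq_fintype_card]
  refine orderOf_eq_card_of_forall_mem_zpowers fun v => ?_
  obtain ⟨t, ht⟩ := ZMod.intCast_surjective (v : ZMod ℓ)
  have htd : ¬ (ℓ : ℤ) ∣ t := fun hd => by
    rw [(ZMod.intCast_zmod_eq_zero_iff_dvd t ℓ).2 hd] at ht
    exact v.ne_zero ht.symm
  obtain ⟨k, hk⟩ := h t htd
  refine ⟨k, Units.ext ?_⟩
  rw [← ht, ← (ZMod.intCast_eq_intCast_iff _ _ _).2 hk]
  simp

/-- The case where the neighbourhood of `0` is a coset of a multiplicative subgroup. -/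
theorem exists_isVanLintSchrijverGraph [Finite F] {Γ : SimpleGraph F}
    (hΓ : ∀ b x y, Γ.Adj (x + b) (y + b) ↔ Γ.Adj x y) {p r : ℕ} (hp : p.Prime) (hr : 0 < r)
    (hcard : Nat.card F = p ^ r) {ω : Fˣ} (hω : ∀ u : Fˣ, u ∈ Subgroup.zpowers ω)
    {n t : ℕ} {c : ℤ} (hn : n ∣ p ^ r - 1)
    (h : IsTwoCycleSet (neighborExponents Γ ω) n ((p ^ t : ℕ) : ℤ) c) {i₀ : ℤ}
    (hi₀ : i₀ ∈ neighborExponents Γ ω) (hfix : (n : ℤ) ∣ ((p ^ t : ℕ) : ℤ) * i₀ + c - i₀) :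
    ∃ Δ : SimpleGraph F, IsVanLintSchrijverGraph Δ ∧ IsScalarIsomorphic Γ Δ := by
  obtain ⟨hn', hA, hs⟩ := h.of_fixed hi₀ hfix
  have hord : orderOf ω = p ^ r - 1 := by
    rw [orderOf_eq_card_of_forall_mem_zpowers hω, ← hcard, Nat.card_units]
  have hpr : 1 ≤ p ^ r := Nat.one_le_pow _ _ hp.pos
  have hpn : p.Coprime n := by
    rw [hp.coprime_iff_not_dvd]
    intro hd
    have h1 : p ∣ p ^ r - 1 := hd.trans hn
    have h2 : p ∣ 1 := by
      simpa [Nat.sub_sub_self hpr] using Nat.dvd_sub (dvd_pow_self p hr.ne') h1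
    exact hp.one_lt.ne' (Nat.dvd_one.1 h2)
  have hordp : orderOf (p : ZMod n) = n - 1 := by
    refine orderOf_natCast_eq_sub_one hn' hpn fun u hu => ?_
    obtain ⟨k, hk⟩ := hs u hu
    exact ⟨t * k, by rw [pow_mul]; exact_mod_cast hk⟩
  -- `n ∣ p ^ r - 1` means `p ^ r ≡ 1` modulo `n`, so the order of `p` divides `r`.
  have hdvd : n - 1 ∣ r := by
    rw [← hordp, orderOf_dvd_iff_pow_eq_one]
    have h1 : ((p ^ r - 1 : ℕ) : ZMod n) = 0 := (ZMod.natCast_eq_zero_iff _ _).2 hn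
    rw [Nat.cast_sub hpr] at h1
    simpa [sub_eq_zero] using h1
  obtain ⟨k, rfl⟩ := hdvd
  obtain ⟨Δ, hΔ, hiso⟩ := exists_isCayleyGraph hΓ hω i₀
    (S := {x : F | ∃ u ∈ Subgroup.zpowers (ω ^ n), x = u})
    (by rintro ⟨u, -, hu⟩; exact u.ne_zero hu.symm) (fun i => by
      rw [hA, Int.modEq_comm, Int.modEq_iff_dvd, add_sub_cancel_right,
        ← zpow_mem_zpowers_pow_iff (hord ▸ hn)]
      constructor
      · rintro ⟨u, hu, hiu⟩
        rwa [Units.ext hiu]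
      · exact fun hi => ⟨_, hi, rfl⟩)
  exact ⟨Δ, ⟨p, n, k, hp, hn', Nat.pos_of_mul_pos_left hr, hordp, hcard, ω,
    (Subgroup.eq_top_iff' _).2 hω, hΔ⟩, hiso⟩

theorem mod_four_eq_three_of_pow {p t : ℕ} (h : p ^ t % 4 = 3) : p % 4 = 3 := by
  have h4 : p % 4 < 4 := Nat.mod_lt _ (by norm_num)
  have ht : t ≠ 0 := by
    rintro rfl
    simp at h
  rw [Nat.pow_mod] at h
  interval_cases hm : p % 4
  · simp [ht] at h
  · simp at h
  · have : (2 ^ t % 4) % 2 = 0 := by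
      rw [Nat.mod_mod_of_dvd _ (by norm_num)]
      exact Nat.mod_eq_zero_of_dvd (dvd_pow_self 2 ht)
    omega
  · rfl

/-- An odd power of `p` would be 3 modulo 4. -/
theorem even_of_four_dvd_pow_sub_one {p r : ℕ} (hp : p % 4 = 3) (h : 4 ∣ p ^ r - 1) : Even r := by
  by_contra hr
  obtain ⟨m, rfl⟩ := Nat.not_even_iff_odd.1 hr
  have h1 : p ^ (2 * m + 1) % 4 = 3 := by
    rw [pow_succ, pow_mul, Nat.mul_mod, Nat.pow_mod, Nat.pow_mod p, hp]
    simp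
  omega

/-- The case where the neighbourhood of `0` is a union of two cosets of the subgroup of fourth
powers. -/
theorem exists_isPeisertGraph [Finite F] {Γ : SimpleGraph F}
    (hΓ : ∀ b x y, Γ.Adj (x + b) (y + b) ↔ Γ.Adj x y) {p r : ℕ} (hp : p.Prime) (hr : 0 < r)
    (hcard : Nat.card F = p ^ r) {ω : Fˣ} (hω : ∀ u : Fˣ, u ∈ Subgroup.zpowers ω)
    {n t : ℕ} {c : ℤ} (hn : n ∣ p ^ r - 1)
    (h : IsTwoCycleSet (neighborExponents Γ ω) n ((p ^ t : ℕ) : ℤ) c)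
    (hfix : ∀ i : ℤ, ¬ (n : ℤ) ∣ ((p ^ t : ℕ) : ℤ) * i + c - i) :
    ∃ Δ : SimpleGraph F, IsPeisertGraph Δ ∧ IsScalarIsomorphic Γ Δ := by
  obtain ⟨rfl, hs, j, hA⟩ := h.of_not_fixed hfix
  have hord : orderOf ω = p ^ r - 1 := by
    rw [orderOf_eq_card_of_forall_mem_zpowers hω, ← hcard, Nat.card_units]
  have hp3 : p % 4 = 3 := mod_four_eq_three_of_pow (by exact_mod_cast hs : p ^ t % 4 = 3)
  obtain ⟨Δ, hΔ, hiso⟩ := exists_isCayleyGraph hΓ hω j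
    (S := {x : F | ∃ u ∈ Subgroup.zpowers (ω ^ 4), x = u ∨ x = u * ω})
    (by
      rintro ⟨u, -, hu | hu⟩
      · exact u.ne_zero hu.symm
      · rw [← Units.val_mul] at hu
        exact (u * ω).ne_zero hu.symm) (fun i => by
      have e1 : i + j ≡ j [ZMOD 4] ↔ (4 : ℤ) ∣ i := by
        rw [Int.modEq_comm, Int.modEq_iff_dvd, add_sub_cancel_right]
      have e2 : i + j ≡ j + 1 [ZMOD 4] ↔ (4 : ℤ) ∣ i - 1 := by
        rw [Int.modEq_comm, Int.modEq_iff_dvd, show i + j - (j + 1) = i - 1 by ring]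
      have e3 := zpow_mem_zpowers_pow_iff (hord ▸ hn)
      push_cast at e3
      rw [hA, e1, e2, ← e3, ← e3]
      constructor
      · rintro ⟨u, hu, hiu | hiu⟩
        · left
          rwa [Units.ext hiu]
        · right
          rw [← Units.val_mul] at hiu
          rwa [zpow_sub_one, Units.ext hiu, mul_inv_cancel_right]
      · rintro (hi | hi)
        · exact ⟨_, hi, Or.inl rfl⟩
        · refine ⟨_, hi, Or.inr ?_⟩
          rw [← Units.val_mul, zpow_sub_one, inv_mul_cancel_right])
  exact ⟨Δ, ⟨p, r, hp, hp3, hr, even_of_four_dvd_pow_sub_one hp3 hn, hcard, ω,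
    (Subgroup.eq_top_iff' _).2 hω, hΔ⟩, hiso⟩

end AffineSemilinear

/-! ### The classification -/

theorem mainTheorem1 {F : Type*} [Field F] [Finite F] (Γ : SimpleGraph F)
    (hΓ : IsAffineRankThreeGraph Γ) :
    ∃ Δ : SimpleGraph F,
      (IsVanLintSchrijverGraph Δ ∨ IsPaleyGraph Δ ∨ IsPeisertGraph Δ) ∧
      (IsScalarIsomorphic Γ Δ ∨ IsScalarIsomorphic Γᶜ Δ) := by
  have : Fintype F := Fintype.ofFinite F
  obtain ⟨p, hchar, r, hp, hcard⟩ := FiniteField.card' F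
  rw [← Nat.card_eq_fintype_card] at hcard
  have : Fact p.Prime := ⟨hp⟩
  obtain ⟨ω, hω⟩ := IsCyclic.exists_generator (α := Fˣ)
  obtain ⟨n, t, c, hn, h⟩ := hΓ.exists_isTwoCycleSet p hω
  rw [Nat.card_units, hcard] at hn
  have htr := hΓ.adj_add_right_iff
  by_cases hfix : ∃ i : ℤ, (n : ℤ) ∣ ((p ^ t : ℕ) : ℤ) * i + c - i
  · obtain ⟨i₀, hi₀⟩ := hfix
    by_cases hmem : i₀ ∈ neighborExponents Γ ω
    · obtain ⟨Δ, h1, h2⟩ := exists_isVanLintSchrijverGraph htr hp r.pos hcard hω hn h hmem hi₀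
      exact ⟨Δ, Or.inl h1, Or.inl h2⟩
    -- The fixed class lies outside `A`, so the complement graph takes the role of `Γ`.
    · have h' := h.compl
      rw [← neighborExponents_compl] at h'
      obtain ⟨Δ, h1, h2⟩ := exists_isVanLintSchrijverGraph (compl_adj_add_right_iff htr) hp r.pos
        hcard hω hn h' (by rwa [neighborExponents_compl]) hi₀
      exact ⟨Δ, Or.inl h1, Or.inr h2⟩
  -- No complement is needed: `A` is already a pair of consecutive classes modulo 4.
  · push Not at hfix
    obtain ⟨Δ, h1, h2⟩ := exists_isPeisertGraph htr hp r.pos hcard hω hn h hfix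
    exact ⟨Δ, Or.inr (Or.inr h1), Or.inl h2⟩
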